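/- All Banach spaces are real. Let $G$ be a compact Hausdorff topological group. A $G$-Banach space is a Banach space $X$ with an action of $G$ by linear isometries such that $G\times X\to X$ is continuous. A set $C\subseteq X$ is $G$-invariant if $g\cdot C\subseteq C$ for all $g\in G$, and $\overline{\mathrm{co}}_G(A)$ denotes the smallest closed convex $G$-invariant subset of $X$ containing $A$. A $G$-invariant set $C\subseteq X$ is $G$-dentable if for every $\varepsilon>0$ there are a finite set $\{x_1,\dots,x_n\}\subseteq C$ and a point $x\in C$ with $$x\notin \overline{\mathrm{co}}_G\Big(C\setminus \bigcup_{i=1}^n B_\varepsilon(x_i)\Big),\qquad B_\varepsilon(x_i)=\{y\in X:\|y-x_i\|<\varepsilon\}.$$ The space $X$ is strongly $G$-dentable if every nonempty bounded $G$-invariant subset of $X$ is $G$-dentable. A set $C\subseteq X$ has the $G$-Bishop–Phelps property if for every $G$-Banach space $Y$, every $G$-equivariant bounded linear operator $T:X\to Y$ and every $\delta>0$ there is a $G$-equivariant bounded linear operator $S:X\to Y$ such that $\|S-T\|<\delta$ and $\sup\{\|S(x)\|:x\in C\}$ is attained at a point of $C$. The space $X$ has the $G$-Bishop–Phelps property if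 every nonempty bounded closed absolutely convex $G$-invariant subset of $X$ has it. Theorem. Let $G$ be a compact Hausdorff topological group and let $X$ be a $G$-Banach space. 1. If $X$ has the $G$-Bishop–Phelps property, then $X$ is strongly $G$-dentable. 2. If $C\subseteq X$ is a separable bounded closed convex $G$-invariant set that has the $G$-Bishop–Phelps property, then $C$ is $G$-dentable. -/

import Mathlib

/-- A continuous action of the topological group `G` on the normed space `X` by linear isometries:
each `g` acts by an additive and homogeneous isometry, and `G × X → X` is jointly continuous.
A `G`-Banach space is a real Banach space with such an action. -/
class IsLinearIsometricAction (G X : Type*) [Group G] [TopologicalSpace G]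
    [NormedAddCommGroup X] [NormedSpace ℝ X] [DistribMulAction G X] : Prop where
  smul_comm : ∀ (g : G) (r : ℝ) (x : X), g • (r • x) = r • (g • x)
  norm_smul : ∀ (g : G) (x : X), ‖g • x‖ = ‖x‖
  continuous_smul : Continuous fun p : G × X => p.1 • p.2

/-- `C` is `G`-invariant: `g • C ⊆ C` for every `g`. -/
def IsGInvariant (G : Type*) {X : Type*} [SMul G X] (C : Set X) : Prop :=
  ∀ (g : G), ∀ x ∈ C, g • x ∈ C

/-- `T` is `G`-equivariant. -/
def IsGEquivariant (G : Type*) {X Y : Type*} [SMul G X] [SMul G Y] (T : X → Y) : Prop :=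
  ∀ (g : G) (x : X), T (g • x) = g • T x

/-- The smallest closed convex `G`-invariant set containing `A`. -/
def closedConvexGHull (G : Type*) {X : Type*} [NormedAddCommGroup X] [NormedSpace ℝ X] [SMul G X]
    (A : Set X) : Set X :=
  ⋂₀ {K : Set X | IsClosed K ∧ Convex ℝ K ∧ IsGInvariant G K ∧ A ⊆ K}

/-- `C` is `G`-dentable. -/
def IsGDentable (G : Type*) {X : Type*} [NormedAddCommGroup X] [NormedSpace ℝ X] [SMul G X]
    (C : Set X) : Prop :=
  ∀ ε : ℝ, 0 < ε → ∃ F : Finset X, (F : Set X) ⊆ C ∧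
    ∃ x ∈ C, x ∉ closedConvexGHull G (C \ ⋃ y ∈ F, Metric.ball y ε)

/-- `X` is strongly `G`-dentable: every nonempty bounded `G`-invariant set is `G`-dentable. -/
def IsStronglyGDentable (G X : Type*) [NormedAddCommGroup X] [NormedSpace ℝ X] [SMul G X] : Prop :=
  ∀ C : Set X, C.Nonempty → Bornology.IsBounded C → IsGInvariant G C → IsGDentable G C

/-- The set `C` has the `G`-Bishop–Phelps property: for every `G`-Banach space `Y`, the
`G`-equivariant operators `S : X → Y` for which `sup {‖S x‖ : x ∈ C}` is attained are dense among
all `G`-equivariant bounded operators. -/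
def SetHasGBishopPhelps.{u, v} (G : Type u) {X : Type v} [Group G] [TopologicalSpace G]
    [NormedAddCommGroup X] [NormedSpace ℝ X] [DistribMulAction G X] (C : Set X) : Prop :=
  ∀ (Y : Type v) [NormedAddCommGroup Y] [NormedSpace ℝ Y] [CompleteSpace Y]
    [DistribMulAction G Y] [IsLinearIsometricAction G Y] (T : X →L[ℝ] Y), IsGEquivariant G T →
    ∀ δ : ℝ, 0 < δ → ∃ S : X →L[ℝ] Y, IsGEquivariant G S ∧ ‖S - T‖ < δ ∧
      ∃ x ∈ C, ∀ y ∈ C, ‖S y‖ ≤ ‖S x‖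

/-- `X` has the `G`-Bishop–Phelps property: every nonempty bounded closed absolutely convex
`G`-invariant subset of `X` has it. -/
def HasGBishopPhelps.{u, v} (G : Type u) (X : Type v) [Group G] [TopologicalSpace G]
    [NormedAddCommGroup X] [NormedSpace ℝ X] [DistribMulAction G X] : Prop :=
  ∀ C : Set X, C.Nonempty → Bornology.IsBounded C → IsClosed C → AbsConvex ℝ C →
    IsGInvariant G C → SetHasGBishopPhelps G C

/-!
The proof uses one renorming. Let `C` be separable and bounded, `(uₙ)` dense in `C`, and `ρ > 0`
small compared with `ε`. Let `pₙ` be the gauge of the `ρ`-neighbourhood of the absolutely convex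
hull of the orbit of `uₙ`. Each `pₙ` is `G`-invariant, and, because the orbit is compact, vectors
with `pₙ` close to `1` or smaller lie near a finite set. The weighted `ℓ²` sum
`N = (∑ 4⁻ⁿ pₙ²)^(1/2)` is an equivalent `G`-invariant norm, so the Bishop–Phelps property applies
to the identity `X → (X, N)` (`SetHasGBishopPhelps.exists_near_id`): some equivariant `S` within
`ρ` of the identity on `C` has `N ∘ S` maximal on `C` at a point `x`. Since `S x` is within `ρ` of
some `uₙ`, `pₙ (S x) ≤ 1`, whereas `pₙ (S y) ≥ 1 + η` for all `y ∈ C` off finitely many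
`ε`-balls. Pairing with the `ℓ²` vector of `S x` gives a continuous `G`-invariant seminorm `φ` with
`φ x = N (S x)²`, and uniform convexity of `ℓ²` bounds `φ y` away from `N (S x)²` for all those `y`
(`supportSeminorm_le_sub`). A sublevel set of `φ` is thus a closed convex invariant set
that contains `C` minus the balls but not `x`; this is `SetHasGBishopPhelps.isGDentable`.

For the first part, a set `C` that is not `G`-dentable contains a countable set `A` on which
dentability fails in the same way (`exists_countable_closed_under`, since membership in a hull has
countable witnesses). The closed absolutely convex invariant hull of `A` is then not `G`-dentable
(`not_isGDentable_orbitHull`), but it is separable since orbits are compact metrizable, so the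
separable case contradicts this.
-/

open Set Metric Topology Pointwise

/-! ### Change of norm -/

/-- The vector space `X` re-equipped with the seminorm `N` as its norm. -/
def Renormed {X : Type*} [NormedAddCommGroup X] [NormedSpace ℝ X] (_N : Seminorm ℝ X) : Type _ := X

namespace Renormed

variable {X : Type*} [NormedAddCommGroup X] [NormedSpace ℝ X] {N : Seminorm ℝ X}

instance : AddCommGroup (Renormed N) := inferInstanceAs (AddCommGroup X)

instance : Module ℝ (Renormed N) := inferInstanceAs (Module ℝ X)

instance : Norm (Renormed N) := ⟨fun x => N (show X from x)⟩

/-- The identity map onto the renormed space. -/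
def of (N : Seminorm ℝ X) : X ≃ₗ[ℝ] Renormed N := LinearEquiv.refl ℝ X

theorem core {a : ℝ} (ha : 0 < a) (hN : ∀ x, a * ‖x‖ ≤ N x) :
    NormedSpace.Core ℝ (Renormed N) where
  norm_nonneg x := apply_nonneg N (show X from x)
  norm_smul c x := map_smul_eq_mul N c (show X from x)
  norm_triangle x y := map_add_le_add N (show X from x) (show X from y)
  norm_eq_zero_iff x := by
    constructor
    · intro h
      have h1 : a * ‖(show X from x)‖ ≤ 0 := (hN _).trans h.le
      have h2 : ‖(show X from x)‖ ≤ 0 := by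
        by_contra! hc
        exact absurd h1 (not_le.2 (mul_pos ha hc))
      exact norm_le_zero_iff.1 h2
    · rintro rfl
      exact map_zero N

end Renormed

/-- The Bishop–Phelps property applied to the identity map from `X` to `X` with an equivalent
`G`-invariant norm `N`. -/
theorem SetHasGBishopPhelps.exists_near_id {G X : Type*} [Group G] [TopologicalSpace G]
    [NormedAddCommGroup X] [NormedSpace ℝ X] [CompleteSpace X]
    [DistribMulAction G X] [IsLinearIsometricAction G X] {C : Set X}
    (hC : SetHasGBishopPhelps G C) (N : Seminorm ℝ X) {a b : ℝ} (ha : 0 < a)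
    (hlow : ∀ x, a * ‖x‖ ≤ N x) (hup : ∀ x, N x ≤ b * ‖x‖)
    (hinv : ∀ (g : G) (x : X), N (g • x) = N x) {δ : ℝ} (hδ : 0 < δ) :
    ∃ S : X →L[ℝ] X, IsGEquivariant G S ∧ (∀ x, N (S x - x) ≤ δ * ‖x‖) ∧
      ∃ x ∈ C, ∀ y ∈ C, N (S y) ≤ N (S x) := by
  let : NormedAddCommGroup (Renormed N) := NormedAddCommGroup.ofCore (Renormed.core ha hlow)
  let : NormedSpace ℝ (Renormed N) := NormedSpace.ofCore (Renormed.core ha hlow)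
  let e : X ≃L[ℝ] Renormed N :=
    LinearEquiv.toContinuousLinearEquivOfBounds (Renormed.of N) b a⁻¹ hup fun y => by
      have := hlow ((Renormed.of N).symm y)
      rw [inv_mul_eq_div, le_div_iff₀ ha, mul_comm]
      exact this
  have : CompleteSpace (Renormed N) :=
    (completeSpace_congr (e := e.toEquiv) e.isUniformEmbedding).1 inferInstance
  let : DistribMulAction G (Renormed N) :=
    { smul := fun g y => e (g • e.symm y)
      one_smul := fun y => by change e ((1 : G) • e.symm y) = y; simp
      mul_smul := fun g h y => by
        change e ((g * h) • e.symm y) = e (g • e.symm (e (h • e.symm y)))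
        simp [mul_smul]
      smul_zero := fun g => by change e (g • e.symm 0) = 0; simp
      smul_add := fun g y z => by
        change e (g • e.symm (y + z)) = e (g • e.symm y) + e (g • e.symm z)
        simp }
  have hsmul (g : G) (y : Renormed N) : g • y = e (g • e.symm y) := rfl
  have : IsLinearIsometricAction G (Renormed N) :=
    { smul_comm := fun g r y => by
        simp only [hsmul, map_smul, IsLinearIsometricAction.smul_comm]
      norm_smul := fun g y => hinv g (e.symm y)
      continuous_smul := by
        have h := (IsLinearIsometricAction.continuous_smul (G := G) (X := X)).comp
          (continuous_id.prodMap e.symm.continuous)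
        exact e.continuous.comp h }
  obtain ⟨S, hS, hnorm, x, hx, hmax⟩ := hC (Renormed N) (e : X →L[ℝ] Renormed N)
    (fun g x => by simp [hsmul]) δ hδ
  refine ⟨(e.symm : Renormed N →L[ℝ] X).comp S, fun g z => ?_, fun z => ?_, x, hx, hmax⟩
  · simp [hS g z, hsmul]
  · calc ‖(S - (e : X →L[ℝ] Renormed N)) z‖ ≤ ‖S - (e : X →L[ℝ] Renormed N)‖ * ‖z‖ :=
          ContinuousLinearMap.le_opNorm _ _
      _ ≤ δ * ‖z‖ := by gcongr

/-! ### The weighted `ℓ²` sum of a sequence of seminorms -/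

section WeightedSum

variable {X : Type*} [NormedAddCommGroup X] [NormedSpace ℝ X] {p : ℕ → Seminorm ℝ X} {K : ℝ}

theorem weight_mul_sq_le (hp : ∀ n x, p n x ≤ K * ‖x‖) (x : X) (n : ℕ) :
    ‖(1 / 2 : ℝ) ^ n * p n x‖ ^ (2 : ENNReal).toReal ≤ (K * ‖x‖) ^ 2 * (1 / 4 : ℝ) ^ n := by
  have h : (1 / 4 : ℝ) ^ n = ((1 / 2) ^ n) ^ 2 := by rw [← pow_mul, mul_comm, pow_mul]; norm_num
  rw [Real.norm_of_nonneg (mul_nonneg (by positivity) (apply_nonneg _ _)), h, ← mul_pow,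
    ENNReal.toReal_ofNat, Real.rpow_ofNat, mul_comm]
  have := hp n x
  gcongr

/-- The sequence `2⁻ⁿ pₙ(x)` as an element of `ℓ²`. -/
noncomputable def weightedSeq (hp : ∀ n x, p n x ≤ K * ‖x‖) (x : X) : lp (fun _ : ℕ => ℝ) 2 :=
  ⟨fun n => (1 / 2 : ℝ) ^ n * p n x, memℓp_gen <|
    Summable.of_nonneg_of_le (fun n => by positivity) (weight_mul_sq_le hp x)
      ((summable_geometric_of_lt_one (by norm_num) (by norm_num)).mul_left _)⟩

variable (hp : ∀ n x, p n x ≤ K * ‖x‖)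

theorem weightedSeq_apply (x : X) (n : ℕ) : weightedSeq hp x n = (1 / 2 : ℝ) ^ n * p n x := rfl

theorem weightedSeq_nonneg (x : X) (n : ℕ) : 0 ≤ weightedSeq hp x n :=
  mul_nonneg (by positivity) (apply_nonneg _ _)

theorem inner_le_inner_of_nonneg_of_le {u v w : lp (fun _ : ℕ => ℝ) 2} (hu : ∀ n, 0 ≤ u n)
    (hvw : ∀ n, v n ≤ w n) : inner ℝ u v ≤ inner ℝ u w :=
  hasSum_le (fun n => by simpa [mul_comm] using mul_le_mul_of_nonneg_left (hvw n) (hu n))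
    (lp.hasSum_inner u v) (lp.hasSum_inner u w)

theorem weightedSeq_smul (r : ℝ) (x : X) :
    weightedSeq hp (r • x) = |r| • weightedSeq hp x := by
  ext n
  simp [weightedSeq_apply, map_smul_eq_mul]
  ring

theorem weightedSeq_add_le (x y : X) (n : ℕ) :
    weightedSeq hp (x + y) n ≤ (weightedSeq hp x + weightedSeq hp y) n := by
  have := map_add_le_add (p n) x y
  simp only [weightedSeq_apply, lp.coeFn_add, Pi.add_apply, ← mul_add]
  gcongr

/-- `y ↦ ⟪u, (2⁻ⁿ pₙ(y))ₙ⟫` is a seminorm when `u ∈ ℓ²` has nonnegative coordinates. -/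
noncomputable def pairingSeminorm (u : lp (fun _ : ℕ => ℝ) 2) (hu : ∀ n, 0 ≤ u n) :
    Seminorm ℝ X :=
  Seminorm.of (fun y => inner ℝ u (weightedSeq hp y))
    (fun x y => by
      rw [← inner_add_right]
      exact inner_le_inner_of_nonneg_of_le hu (weightedSeq_add_le hp x y))
    (fun r x => by rw [weightedSeq_smul, real_inner_smul_right, Real.norm_eq_abs])

/-- The weighted `ℓ²` sum `N(x) = (∑ 4⁻ⁿ pₙ(x)²)^(1/2)`. -/
noncomputable def l2SumSeminorm : Seminorm ℝ X :=
  Seminorm.of (fun x => ‖weightedSeq hp x‖)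
    (fun x y => by
      set u := weightedSeq hp (x + y) with hu
      have h1 : ‖u‖ * ‖u‖ ≤ ‖u‖ * (‖weightedSeq hp x‖ + ‖weightedSeq hp y‖) := by
        rw [← real_inner_self_eq_norm_mul_norm]
        calc inner ℝ u u ≤ inner ℝ u (weightedSeq hp x + weightedSeq hp y) :=
              inner_le_inner_of_nonneg_of_le (weightedSeq_nonneg hp _) (weightedSeq_add_le hp x y)
          _ ≤ ‖u‖ * ‖weightedSeq hp x + weightedSeq hp y‖ := real_inner_le_norm _ _
          _ ≤ _ := by gcongr; exact norm_add_le _ _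
      rcases (norm_nonneg u).eq_or_lt with h | h
      · rw [← h]; positivity
      · exact le_of_mul_le_mul_left h1 h)
    (fun r x => by rw [weightedSeq_smul, norm_smul]; simp)

theorem l2SumSeminorm_apply (x : X) : l2SumSeminorm hp x = ‖weightedSeq hp x‖ := rfl

theorem le_l2SumSeminorm (x : X) (n : ℕ) : (1 / 2 : ℝ) ^ n * p n x ≤ l2SumSeminorm hp x :=
  (Real.norm_of_nonneg (weightedSeq_nonneg hp x n)).symm.le.trans
    (lp.norm_apply_le_norm (by norm_num) (weightedSeq hp x) n)

theorem weightedSeq_congr {x y : X} (h : ∀ n, p n x = p n y) :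
    weightedSeq hp x = weightedSeq hp y := by
  ext n
  simp [weightedSeq_apply, h]

theorem l2SumSeminorm_le (x : X) : l2SumSeminorm hp x ≤ 2 * K * ‖x‖ := by
  have hK : 0 ≤ K * ‖x‖ := (apply_nonneg (p 0) x).trans (hp 0 x)
  rw [l2SumSeminorm_apply]
  refine lp.norm_le_of_tsum_le (by norm_num) (by nlinarith) ?_
  have h4 := summable_geometric_of_lt_one (r := (1 / 4 : ℝ)) (by norm_num) (by norm_num)
  have hle (n : ℕ) : ‖weightedSeq hp x n‖ ^ (2 : ENNReal).toReal ≤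
      (K * ‖x‖) ^ 2 * (1 / 4 : ℝ) ^ n := by
    rw [weightedSeq_apply]
    exact weight_mul_sq_le hp x n
  refine (Summable.tsum_le_tsum hle ((lp.memℓp _).summable (by norm_num))
    (h4.mul_left _)).trans ?_
  rw [tsum_mul_left, tsum_geometric_of_lt_one (by norm_num) (by norm_num),
    ENNReal.toReal_ofNat, Real.rpow_ofNat]
  nlinarith

/-- The supporting seminorm of `N = l2SumSeminorm` at `x`: it equals `N(x)²` at `x` and,
by uniform convexity of `ℓ²`, it drops by a fixed amount on the vectors `y` with `N(y) ≤ N(x)`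
one of whose coordinates `pₙ(y)` stays away from `pₙ(x)`. -/
noncomputable def supportSeminorm (x : X) : Seminorm ℝ X :=
  pairingSeminorm hp (weightedSeq hp x) (weightedSeq_nonneg hp x)

theorem supportSeminorm_apply (x y : X) :
    supportSeminorm hp x y = inner ℝ (weightedSeq hp x) (weightedSeq hp y) := rfl

theorem supportSeminorm_self (x : X) : supportSeminorm hp x x = l2SumSeminorm hp x ^ 2 := by
  rw [supportSeminorm_apply, l2SumSeminorm_apply, real_inner_self_eq_norm_sq]

theorem supportSeminorm_le (x y : X) :
    supportSeminorm hp x y ≤ l2SumSeminorm hp x * (2 * K) * ‖y‖ := by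
  rw [supportSeminorm_apply, mul_assoc]
  refine (real_inner_le_norm _ _).trans ?_
  exact mul_le_mul_of_nonneg_left (l2SumSeminorm_le hp y) (norm_nonneg _)

theorem continuous_supportSeminorm (x : X) : Continuous (supportSeminorm hp x) :=
  Seminorm.continuous_of_continuousAt_zero <| by
    have h : Continuous fun y : X => l2SumSeminorm hp x * (2 * K) * ‖y‖ := by fun_prop
    rw [ContinuousAt, map_zero]
    exact squeeze_zero (fun y => apply_nonneg _ y) (supportSeminorm_le hp x)
      (h.tendsto' 0 0 (by simp))

theorem supportSeminorm_le_sub {x y : X} (hxy : l2SumSeminorm hp y ≤ l2SumSeminorm hp x) {n : ℕ}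
    {η : ℝ} (hη : 0 ≤ η) (h : p n x + η ≤ p n y) :
    supportSeminorm hp x y ≤ l2SumSeminorm hp x ^ 2 - ((1 / 2 : ℝ) ^ n * η) ^ 2 / 2 := by
  have h1 : (1 / 2 : ℝ) ^ n * η ≤ ‖weightedSeq hp y - weightedSeq hp x‖ := by
    refine le_trans ?_ (lp.norm_apply_le_norm (by norm_num) _ n)
    refine le_trans ?_ (Real.le_norm_self _)
    simp only [lp.coeFn_sub, Pi.sub_apply, weightedSeq_apply, ← mul_sub]
    gcongr
    linarith
  have h2 := norm_sub_sq_real (weightedSeq hp y) (weightedSeq hp x)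
  rw [real_inner_comm] at h2
  have h3 : ((1 / 2 : ℝ) ^ n * η) ^ 2 ≤ ‖weightedSeq hp y - weightedSeq hp x‖ ^ 2 := by gcongr
  have h4 : ‖weightedSeq hp y‖ ^ 2 ≤ ‖weightedSeq hp x‖ ^ 2 := by gcongr; exact hxy
  rw [supportSeminorm_apply, l2SumSeminorm_apply]
  linarith

end WeightedSum

/-! ### Gauges of thickened orbit hulls -/

theorem isGInvariant_orbit {G X : Type*} [Group G] [MulAction G X] (x : X) :
    IsGInvariant G (MulAction.orbit G x) :=
  fun g _ hy => MulAction.mem_orbit_of_mem_orbit g hy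

section Action

variable {G X : Type*} [Group G] [NormedAddCommGroup X] [NormedSpace ℝ X] [DistribMulAction G X]

variable (G) in
/-- The open `ρ`-neighbourhood of the absolutely convex hull of the orbit of `x`. -/
def thickHull (ρ : ℝ) (x : X) : Set X := absConvexHull ℝ (MulAction.orbit G x) + ball 0 ρ

theorem absConvex_thickHull (ρ : ℝ) (x : X) : AbsConvex ℝ (thickHull G ρ x) :=
  ⟨balanced_absConvexHull.add balanced_ball_zero, convex_absConvexHull.add (convex_ball 0 ρ)⟩

theorem ball_subset_thickHull (ρ : ℝ) (x z : X) (hz : z ∈ absConvexHull ℝ (MulAction.orbit G x)) :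
    ball z ρ ⊆ thickHull G ρ x := fun y hy =>
  ⟨z, hz, y - z, by simpa [dist_eq_norm] using hy, by simp⟩

theorem ball_zero_subset_thickHull (ρ : ℝ) (x : X) : ball 0 ρ ⊆ thickHull G ρ x :=
  ball_subset_thickHull ρ x 0 <| balanced_absConvexHull.zero_mem
    ⟨x, subset_absConvexHull (MulAction.mem_orbit_self x)⟩

theorem absorbent_thickHull {ρ : ℝ} (hρ : 0 < ρ) (x : X) : Absorbent ℝ (thickHull G ρ x) :=
  (absorbent_ball_zero hρ).mono (ball_zero_subset_thickHull ρ x)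

variable (G) in
/-- The gauge of `thickHull G ρ x`. -/
noncomputable def thickSeminorm {ρ : ℝ} (hρ : 0 < ρ) (x : X) : Seminorm ℝ X :=
  gaugeSeminorm (absConvex_thickHull (G := G) ρ x).1 (absConvex_thickHull ρ x).2
    (absorbent_thickHull hρ x)

variable {ρ : ℝ} (hρ : 0 < ρ)

theorem thickSeminorm_le (x y : X) : thickSeminorm G hρ x y ≤ ρ⁻¹ * ‖y‖ := by
  rw [inv_mul_eq_div, le_div_iff₀ hρ, mul_comm]
  exact mul_gauge_le_norm (ball_zero_subset_thickHull ρ x)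

theorem thickSeminorm_le_one {x y : X} (hxy : dist y x < ρ) : thickSeminorm G hρ x y ≤ 1 :=
  gauge_le_one_of_mem <| ball_subset_thickHull ρ x x
    (subset_absConvexHull (MulAction.mem_orbit_self x)) hxy

variable [TopologicalSpace G] [IsLinearIsometricAction G X]

theorem continuous_smul_const_of_isLinearIsometricAction (g : G) :
    Continuous fun x : X => g • x :=
  IsLinearIsometricAction.continuous_smul.comp (by fun_prop : Continuous fun x : X => (g, x))

/-- The action of a group element as a linear map. -/
def actionLinearMap (X : Type*) [NormedAddCommGroup X] [NormedSpace ℝ X]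
    [DistribMulAction G X] [IsLinearIsometricAction G X] (g : G) : X →ₗ[ℝ] X where
  toFun x := g • x
  map_add' := smul_add g
  map_smul' r x := IsLinearIsometricAction.smul_comm g r x

theorem Convex.preimage_action {K : Set X} (hK : Convex ℝ K) (g : G) :
    Convex ℝ {x | g • x ∈ K} :=
  hK.linear_preimage (actionLinearMap X g)

theorem AbsConvex.preimage_action {K : Set X} (hK : AbsConvex ℝ K) (g : G) :
    AbsConvex ℝ {x | g • x ∈ K} := by
  refine ⟨(balanced_iff_neg_mem (hK.2.preimage_action g)).2 fun x hx => ?_,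
    hK.2.preimage_action g⟩
  simpa only [mem_ofPred_eq, smul_neg] using hK.1.neg_mem_iff.2 hx

theorem IsGInvariant.absConvexHull {A : Set X} (hA : IsGInvariant G A) :
    IsGInvariant G (absConvexHull ℝ A) := fun g _ hx =>
  absConvexHull_min (t := {x | g • x ∈ _root_.absConvexHull ℝ A})
    (fun a ha => subset_absConvexHull (hA g a ha)) (absConvex_absConvexHull.preimage_action g) hx

theorem IsGInvariant.closedAbsConvexHull {A : Set X} (hA : IsGInvariant G A) :
    IsGInvariant G (closedAbsConvexHull ℝ A) := fun g _ hx =>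
  closedAbsConvexHull_min (t := {x | g • x ∈ _root_.closedAbsConvexHull ℝ A})
    (fun a ha => subset_closedAbsConvexHull (hA g a ha))
    (absConvex_convexClosedHull.preimage_action g)
    (isClosed_closedAbsConvexHull.preimage (continuous_smul_const_of_isLinearIsometricAction g)) hx

theorem isCompact_orbit [CompactSpace G] (x : X) : IsCompact (MulAction.orbit G x) :=
  isCompact_range <| IsLinearIsometricAction.continuous_smul.comp
    (by fun_prop : Continuous fun g : G => (g, x))

theorem isGInvariant_thickHull (ρ : ℝ) (x : X) : IsGInvariant G (thickHull G ρ x) := by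
  rintro g _ ⟨k, hk, b, hb, rfl⟩
  refine ⟨g • k, (isGInvariant_orbit x).absConvexHull g k hk, g • b, ?_, (smul_add g k b).symm⟩
  simpa [IsLinearIsometricAction.norm_smul] using hb

theorem thickSeminorm_smul_le (x y : X) (g : G) :
    thickSeminorm G hρ x (g • y) ≤ thickSeminorm G hρ x y := by
  refine le_of_forall_gt fun a ha => ?_
  obtain ⟨b, hb, hba, z, hz, rfl⟩ := exists_lt_of_gauge_lt (absorbent_thickHull hρ x) ha
  refine lt_of_le_of_lt (gauge_le_of_mem hb.le ⟨g • z, isGInvariant_thickHull ρ x g z hz, ?_⟩) hba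
  exact (IsLinearIsometricAction.smul_comm g b z).symm

theorem thickSeminorm_smul (x y : X) (g : G) :
    thickSeminorm G hρ x (g • y) = thickSeminorm G hρ x y :=
  (thickSeminorm_smul_le hρ x y g).antisymm <| by
    simpa using thickSeminorm_smul_le hρ x (g • y) g⁻¹

theorem norm_le_of_mem_absConvexHull_orbit {x z : X}
    (hz : z ∈ absConvexHull ℝ (MulAction.orbit G x)) : ‖z‖ ≤ ‖x‖ := by
  have : absConvexHull ℝ (MulAction.orbit G x) ⊆ closedBall 0 ‖x‖ := by
    refine absConvexHull_min ?_ ⟨balanced_closedBall_zero, convex_closedBall _ _⟩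
    rintro _ ⟨g, rfl⟩
    simp [IsLinearIsometricAction.norm_smul]
  simpa using this hz

theorem le_thickSeminorm (x y : X) : (‖x‖ + ρ)⁻¹ * ‖y‖ ≤ thickSeminorm G hρ x y := by
  rw [inv_mul_eq_div]
  refine le_gauge_of_subset_closedBall (absorbent_thickHull hρ x) (by positivity) ?_
  rintro _ ⟨k, hk, b, hb, rfl⟩
  rw [mem_ball_zero_iff] at hb
  rw [mem_closedBall_zero_iff]
  exact (norm_add_le k b).trans (add_le_add (norm_le_of_mem_absConvexHull_orbit hk) hb.le)

/-- Vectors of small gauge lie near the totally bounded hull of the orbit. -/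
theorem exists_dist_le_of_thickSeminorm_lt {x y : X} {η : ℝ}
    (hη : 0 ≤ η) (hηx : η * (‖x‖ + ρ) ≤ ρ) (h : thickSeminorm G hρ x y < 1 + η) :
    ∃ k ∈ absConvexHull ℝ (MulAction.orbit G x), dist y k < 2 * ρ := by
  obtain ⟨b, hb0, hb, _, ⟨k, hk, v, hv, rfl⟩, rfl⟩ :=
    exists_lt_of_gauge_lt (absorbent_thickHull hρ x) h
  rw [mem_ball_zero_iff] at hv
  by_cases hb1 : b ≤ 1
  · refine ⟨b • k, balanced_absConvexHull.smul_mem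
      (by rwa [Real.norm_of_nonneg hb0.le]) hk, ?_⟩
    have : b * ‖v‖ ≤ 1 * ‖v‖ := by gcongr
    simp only [dist_eq_norm, smul_add, add_sub_cancel_left, norm_smul, Real.norm_of_nonneg hb0.le]
    linarith
  · refine ⟨k, hk, ?_⟩
    have h1 : b • (k + v) - k = (b - 1) • (k + v) + v := by module
    have h2 : ‖k + v‖ ≤ ‖x‖ + ρ :=
      (norm_add_le k v).trans (add_le_add (norm_le_of_mem_absConvexHull_orbit hk) hv.le)
    have h3 : (b - 1) * ‖k + v‖ ≤ η * (‖x‖ + ρ) := by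
      gcongr
      linarith
    change dist (b • (k + v)) k < _
    rw [dist_eq_norm, h1]
    refine (norm_add_le _ _).trans_lt ?_
    rw [norm_smul, Real.norm_of_nonneg (by linarith)]
    linarith

end Action

/-! ### Closed convex invariant hulls -/

section Hull

variable {G X : Type*} [NormedAddCommGroup X] [NormedSpace ℝ X]

theorem subset_closedConvexGHull [SMul G X] (A : Set X) : A ⊆ closedConvexGHull G A :=
  subset_sInter fun _ hK => hK.2.2.2

theorem closedConvexGHull_min [SMul G X] {A K : Set X} (hAK : A ⊆ K) (hcl : IsClosed K)
    (hco : Convex ℝ K) (hinv : IsGInvariant G K) : closedConvexGHull G A ⊆ K :=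
  sInter_subset_of_mem ⟨hcl, hco, hinv, hAK⟩

theorem isClosed_closedConvexGHull [SMul G X] (A : Set X) : IsClosed (closedConvexGHull G A) :=
  isClosed_sInter fun _ hK => hK.1

theorem convex_closedConvexGHull [SMul G X] (A : Set X) : Convex ℝ (closedConvexGHull G A) :=
  convex_sInter fun _ hK => hK.2.1

theorem isGInvariant_closedConvexGHull [SMul G X] (A : Set X) :
    IsGInvariant G (closedConvexGHull G A) := fun g _ hx K hK => hK.2.2.1 g _ (hx K hK)

theorem closedConvexGHull_mono [SMul G X] {A B : Set X} (h : A ⊆ B) :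
    closedConvexGHull G A ⊆ closedConvexGHull G B :=
  closedConvexGHull_min (h.trans (subset_closedConvexGHull B)) (isClosed_closedConvexGHull B)
    (convex_closedConvexGHull B) (isGInvariant_closedConvexGHull B)

theorem neg_mem_closedConvexGHull_neg [Group G] [DistribMulAction G X] {A : Set X} {x : X}
    (hx : x ∈ closedConvexGHull G A) : -x ∈ closedConvexGHull G (-A) :=
  closedConvexGHull_min (K := -closedConvexGHull G (-A))
    (fun a ha => subset_closedConvexGHull _ (by simpa using ha))
    (isClosed_closedConvexGHull _).neg (convex_closedConvexGHull _).neg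
    (fun g y hy => by
      have := isGInvariant_closedConvexGHull (G := G) (-A) g _ hy
      rwa [smul_neg] at this) hx

/-- A point of the closed convex invariant hull of `V` lies in the hull of a countable subset
of `V`. -/
theorem exists_countable_of_mem_closedConvexGHull [SMul G X] {V : Set X} {x : X}
    (hx : x ∈ closedConvexGHull G V) :
    ∃ B ⊆ V, B.Countable ∧ x ∈ closedConvexGHull G B := by
  refine closedConvexGHull_min
    (K := {x | ∃ B ⊆ V, B.Countable ∧ x ∈ closedConvexGHull G B}) ?_ ?_ ?_ ?_ hx
  · exact fun v hv => ⟨{v}, by simpa using hv, countable_singleton v,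
      subset_closedConvexGHull _ rfl⟩
  · refine isClosed_of_closure_subset fun y hy => ?_
    obtain ⟨u, hu, hlim⟩ := mem_closure_iff_seq_limit.1 hy
    choose B hBV hBc hB using hu
    exact ⟨⋃ n, B n, iUnion_subset hBV, countable_iUnion hBc,
      (isClosed_closedConvexGHull _).mem_of_tendsto hlim <| Filter.Eventually.of_forall fun n =>
        closedConvexGHull_mono (subset_iUnion B n) (hB n)⟩
  · rintro y ⟨B, hBV, hBc, hB⟩ z ⟨B', hBV', hBc', hB'⟩ a b ha hb hab
    exact ⟨B ∪ B', union_subset hBV hBV', hBc.union hBc', convex_closedConvexGHull _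
      (closedConvexGHull_mono subset_union_left hB)
      (closedConvexGHull_mono subset_union_right hB') ha hb hab⟩
  · rintro g y ⟨B, hBV, hBc, hB⟩
    exact ⟨B, hBV, hBc, isGInvariant_closedConvexGHull B g y hB⟩

end Hull

/-! ### Separable sets -/

/-- Finitely many balls with arbitrary centres can be traded, inside `C`, for finitely many
balls of twice the radius centred in `C`. -/
theorem exists_finset_subset_inter_balls_subset {X : Type*} [PseudoMetricSpace X]
    (C : Set X) {F : Set X} (hF : F.Finite) (r : ℝ) :
    ∃ F' : Finset X, (F' : Set X) ⊆ C ∧ C ∩ ⋃ y ∈ F, ball y r ⊆ ⋃ y ∈ F', ball y (2 * r) := by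
  classical
  choose! c hc using fun y (hy : (C ∩ ball y r).Nonempty) => hy
  refine ⟨(hF.subset (sep_subset F fun y => (C ∩ ball y r).Nonempty)).toFinset.image c, ?_, ?_⟩
  · intro z hz
    simp only [Finset.coe_image, Finite.coe_toFinset, mem_image, mem_ofPred_eq] at hz
    obtain ⟨y, ⟨-, hy⟩, rfl⟩ := hz
    exact (hc y hy).1
  · rintro z ⟨hzC, hz⟩
    simp only [mem_iUnion] at hz ⊢
    obtain ⟨y, hyF, hzy⟩ := hz
    have hne : (C ∩ ball y r).Nonempty := ⟨z, hzC, hzy⟩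
    refine ⟨c y, Finset.mem_image_of_mem c (by simpa using ⟨hyF, hne⟩), ?_⟩
    have h1 := mem_ball.1 hzy
    have h2 := mem_ball'.1 (hc y hne).2
    rw [mem_ball]
    linarith [dist_triangle z y (c y)]

/-- A separable bounded set with the `G`-Bishop–Phelps property is `G`-dentable. -/
theorem SetHasGBishopPhelps.isGDentable {G X : Type*} [Group G] [TopologicalSpace G]
    [CompactSpace G] [NormedAddCommGroup X] [NormedSpace ℝ X] [CompleteSpace X]
    [DistribMulAction G X] [IsLinearIsometricAction G X] {C : Set X}
    (hsep : TopologicalSpace.IsSeparable C) (hbdd : Bornology.IsBounded C)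
    (hC : SetHasGBishopPhelps G C) : IsGDentable G C := by
  intro ε hε
  obtain ⟨R, hR⟩ := hbdd.exists_norm_le
  obtain ⟨t, htC, htc, hCt⟩ := hsep.exists_countable_dense_subset
  -- The property, applied to any operator, yields a point of `C`, so `C` is not empty.
  have hne : t.Nonempty := by
    obtain ⟨-, -, -, x, hx, -⟩ := hC X 0 (fun g x => by simp) 1 one_pos
    exact closure_nonempty_iff.1 ⟨x, hCt hx⟩
  obtain ⟨u, rfl⟩ := htc.exists_eq_range hne
  -- A point `y` with `pₙ (S y) < 1 + η` lies within `ρ + 2ρ + ρ = 4ρ` of a finite net, and moving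
  -- the centres of the net into `C` doubles this radius.
  set ρ : ℝ := ε / 8 with hρε
  have hρ : 0 < ρ := by positivity
  have hR0 : 0 ≤ R := (norm_nonneg _).trans (hR _ (htC ⟨0, rfl⟩))
  let p : ℕ → Seminorm ℝ X := fun n => thickSeminorm G hρ (u n)
  have hp (n : ℕ) (x : X) : p n x ≤ ρ⁻¹ * ‖x‖ := thickSeminorm_le hρ _ _
  have ha : 0 < (‖u 0‖ + ρ)⁻¹ := by positivity
  have hlow (x : X) : (‖u 0‖ + ρ)⁻¹ * ‖x‖ ≤ l2SumSeminorm hp x :=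
    (le_thickSeminorm hρ (u 0) x).trans (by simpa using le_l2SumSeminorm hp x 0)
  have hpinv (n : ℕ) (g : G) (x : X) : p n (g • x) = p n x := thickSeminorm_smul hρ _ _ _
  have hLinv (g : G) (x : X) : weightedSeq hp (g • x) = weightedSeq hp x :=
    weightedSeq_congr hp fun n => hpinv n g x
  -- This tolerance makes `S` move the points of `C` by less than `ρ` in the original norm.
  obtain ⟨S, hS, hSN, x, hx, hmax⟩ := hC.exists_near_id (l2SumSeminorm hp) ha hlow
    (l2SumSeminorm_le hp) (fun g x => by simp only [l2SumSeminorm_apply, hLinv])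
    (δ := (‖u 0‖ + ρ)⁻¹ * (ρ / (2 * (R + 1)))) (by positivity)
  have hSC (y : X) (hy : y ∈ C) : dist (S y) y < ρ := by
    have h1 : (‖u 0‖ + ρ)⁻¹ * ‖S y - y‖ ≤ (‖u 0‖ + ρ)⁻¹ * (ρ / (2 * (R + 1)) * ‖y‖) := by
      rw [← mul_assoc]
      exact (hlow _).trans (hSN y)
    have h2 := le_of_mul_le_mul_left h1 ha
    have h3 : ρ / (2 * (R + 1)) * ‖y‖ ≤ ρ / (2 * (R + 1)) * R := by gcongr; exact hR y hy
    have h4 : ρ / (2 * (R + 1)) * R < ρ := by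
      rw [div_mul_eq_mul_div, div_lt_iff₀ (by positivity)]
      nlinarith
    rw [dist_eq_norm]
    linarith
  have hSx := hSC x hx
  obtain ⟨n, hn⟩ : ∃ n, dist x (u n) < ρ - dist (S x) x := by
    have := Metric.mem_closure_range_iff.1 (hCt hx) (ρ - dist (S x) x) (by linarith)
    exact this
  have hpx : p n (S x) ≤ 1 :=
    thickSeminorm_le_one hρ (by linarith [dist_triangle (S x) x (u n)])
  -- Enlarging the thickened hull of the orbit of `u n` by the factor `1 + η` moves it by at most
  -- `ρ`.
  set η : ℝ := ρ / (‖u n‖ + ρ) with hη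
  have hη0 : 0 < η := by positivity
  obtain ⟨F, hF, hFK⟩ := Metric.totallyBounded_iff.1
    (isCompact_orbit (G := G) (u n)).totallyBounded.absConvexHull ρ hρ
  obtain ⟨F', hF'C, hF'⟩ := exists_finset_subset_inter_balls_subset C hF (4 * ρ)
  have h8 : 2 * (4 * ρ) = ε := by rw [hρε]; ring
  rw [h8] at hF'
  -- Off the chosen balls, `S y` stays away from the hull of the orbit of `u n`.
  have hfar (y : X) (hy : y ∈ C \ ⋃ z ∈ F', ball z ε) : p n (S x) + η ≤ p n (S y) := by
    by_contra! hlt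
    obtain ⟨k, hk, hyk⟩ := exists_dist_le_of_thickSeminorm_lt hρ hη0.le
      (div_mul_cancel₀ ρ (by positivity)).le (show p n (S y) < 1 + η by linarith)
    obtain ⟨f, hf, hkf⟩ := mem_iUnion₂.1 (hFK hk)
    refine hy.2 (hF' ⟨hy.1, mem_iUnion₂.2 ⟨f, hf, ?_⟩⟩)
    have h1 := mem_ball.1 hkf
    have h2 := hSC y hy.1
    rw [dist_comm] at h2
    rw [mem_ball]
    linarith [dist_triangle4 y (S y) k f]
  set c : ℝ := ((1 / 2 : ℝ) ^ n * η) ^ 2 / 2 with hc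
  have hc0 : 0 < c := by positivity
  let φ : Seminorm ℝ X := (supportSeminorm hp (S x)).comp (S : X →ₗ[ℝ] X)
  have hφcont : Continuous φ :=
    (continuous_supportSeminorm hp (S x)).comp S.continuous
  refine ⟨F', hF'C, x, hx, fun hmem => ?_⟩
  have hle : φ x ≤ l2SumSeminorm hp (S x) ^ 2 - c := by
    refine closedConvexGHull_min (K := {z | φ z ≤ l2SumSeminorm hp (S x) ^ 2 - c}) ?_
      (isClosed_le hφcont continuous_const) ?_ ?_ hmem
    · exact fun y hy => supportSeminorm_le_sub hp (hmax y hy.1) hη0.le (hfar y hy)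
    · simpa using φ.convexOn.convex_le (l2SumSeminorm hp (S x) ^ 2 - c)
    · intro g z hz
      have : φ (g • z) = φ z := by
        change supportSeminorm hp (S x) (S (g • z)) = supportSeminorm hp (S x) (S z)
        rw [hS, supportSeminorm_apply, hLinv, supportSeminorm_apply]
      simpa only [mem_ofPred_eq, this] using hz
  have hself : φ x = l2SumSeminorm hp (S x) ^ 2 := supportSeminorm_self hp (S x)
  linarith

/-! ### Separable reduction -/

/-- A nonempty set closed under an operation that sends a finite subset and a point to a countable
set has a nonempty countable subset closed under the same operation. -/
theorem exists_countable_closed_under {X : Type*} {C : Set X} (hC : C.Nonempty)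
    (Φ : Finset X → X → Set X) (hcount : ∀ F x, (Φ F x).Countable)
    (hΦ : ∀ F : Finset X, (F : Set X) ⊆ C → ∀ x ∈ C, Φ F x ⊆ C) :
    ∃ A ⊆ C, A.Nonempty ∧ A.Countable ∧
      ∀ F : Finset X, (F : Set X) ⊆ A → ∀ x ∈ A, Φ F x ⊆ A := by
  obtain ⟨c, hc⟩ := hC
  let step : Set X → Set X := fun A => A ∪ ⋃ F ∈ {F : Finset X | (F : Set X) ⊆ A}, ⋃ x ∈ A, Φ F x
  let A : ℕ → Set X := fun n => step^[n] {c}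
  have hsucc (n : ℕ) : A (n + 1) = step (A n) := Function.iterate_succ_apply' step n {c}
  have hmono : Monotone A := monotone_nat_of_le_succ fun n => by
    rw [hsucc]; exact subset_union_left
  have hAC (n : ℕ) : A n ⊆ C := by
    induction n with
    | zero => simpa [A] using hc
    | succ n ih =>
      rw [hsucc]
      exact union_subset ih <| iUnion₂_subset fun F hF => iUnion₂_subset fun x hx =>
        hΦ F (hF.trans ih) x (ih hx)
  have hAc (n : ℕ) : (A n).Countable := by
    induction n with
    | zero => exact countable_singleton c
    | succ n ih =>
      rw [hsucc]
      have hfin : {F : Finset X | (F : Set X) ⊆ A n}.Countable :=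
        ((countable_ofPred_finite_subset ih).preimage_of_injOn
          (f := fun F : Finset X => (F : Set X))
          Finset.coe_injective.injOn).mono fun F hF => And.intro F.finite_toSet hF
      exact ih.union <| hfin.biUnion fun F _ => ih.biUnion fun x _ => hcount F x
  refine ⟨⋃ n, A n, iUnion_subset hAC, ⟨c, mem_iUnion.2 ⟨0, rfl⟩⟩, countable_iUnion hAc,
    fun F hF x hx => ?_⟩
  obtain ⟨m, hm⟩ := hmono.directed_le.exists_mem_subset_of_finset_subset_biUnion hF
  obtain ⟨k, hk⟩ := mem_iUnion.1 hx
  refine Subset.trans ?_ (subset_iUnion A (max m k + 1))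
  rw [hsucc]
  exact subset_union_of_subset_right (subset_biUnion_of_mem (u := fun x => Φ F x)
    (hmono (le_max_right m k) hk) |>.trans <| subset_biUnion_of_mem
      (u := fun F : Finset X => ⋃ x ∈ A (max m k), Φ F x)
      (show F ∈ {F : Finset X | (F : Set X) ⊆ A (max m k)} from
        hm.trans (hmono (le_max_left m k)))) _

section Reduction

variable {G X : Type*} [Group G] [NormedAddCommGroup X] [NormedSpace ℝ X] [DistribMulAction G X]

/-- The closed absolutely convex invariant hull of `A`. -/
def orbitHull (G : Type*) {X : Type*} [Group G] [NormedAddCommGroup X] [NormedSpace ℝ X]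
    [DistribMulAction G X] (A : Set X) : Set X :=
  closedAbsConvexHull ℝ (⋃ a ∈ A, MulAction.orbit G a)

theorem subset_orbitHull (A : Set X) : A ⊆ orbitHull G A := fun a ha =>
  subset_closedAbsConvexHull (mem_iUnion₂.2 ⟨a, ha, MulAction.mem_orbit_self a⟩)

theorem orbitHull_min {A K : Set X} (hAK : A ⊆ K) (hK : AbsConvex ℝ K) (hcl : IsClosed K)
    (hinv : IsGInvariant G K) : orbitHull G A ⊆ K :=
  closedAbsConvexHull_min (iUnion₂_subset fun a ha => by
    rintro _ ⟨g, rfl⟩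
    exact hinv g a (hAK ha)) hK hcl

/-- If every point of `A` stays in the closed convex invariant hull of `A` minus finitely many
`ε`-balls centred in `A`, then `orbitHull G A` is not `G`-dentable. -/
theorem not_isGDentable_orbitHull {A : Set X} {ε : ℝ} (hε : 0 < ε)
    (hA : ∀ F : Finset X, (F : Set X) ⊆ A →
      ∀ x ∈ A, x ∈ closedConvexGHull G (A \ ⋃ y ∈ F, ball y ε)) :
    ¬ IsGDentable G (orbitHull G A) := by
  intro hdent
  obtain ⟨F₀, -, x₀, hx₀, hx₀F⟩ := hdent (ε / 2) (by positivity)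
  set D := orbitHull G A with hD
  let H : Set X → Set X := fun F => closedConvexGHull G (D \ ⋃ y ∈ F, ball y (ε / 2))
  have hDneg : -D = D := (absConvex_convexClosedHull (𝕜 := ℝ)).1.neg_eq
  have hHneg (F : Set X) {x : X} (hx : x ∈ H F) : -x ∈ H (-F) := by
    have h := neg_mem_closedConvexGHull_neg hx
    refine closedConvexGHull_mono (fun y hy => ?_) h
    refine ⟨hDneg ▸ hy.1, fun hyF => hy.2 ?_⟩
    obtain ⟨z, hz, hyz⟩ := mem_iUnion₂.1 hyF
    exact mem_iUnion₂.2 ⟨-z, hz, by rwa [mem_ball, dist_neg_neg]⟩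
  -- The intersection of all `H F` is symmetric, because `-(H F) = H (-F)`.
  let I : Set X := ⋂ F ∈ {F : Set X | F.Finite}, H F
  have hIcv : Convex ℝ I := convex_iInter₂ fun F _ => convex_closedConvexGHull _
  have hDI : D ⊆ I := by
    refine orbitHull_min (fun a ha => mem_iInter₂.2 fun F hF => ?_)
      ⟨(balanced_iff_neg_mem hIcv).2 fun x hx => mem_iInter₂.2 fun F hF => ?_, hIcv⟩
      (isClosed_biInter fun F _ => isClosed_closedConvexGHull _)
      (fun g x hx => mem_iInter₂.2 fun F hF =>
        isGInvariant_closedConvexGHull _ g x (mem_iInter₂.1 hx F hF))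
    · obtain ⟨F', hF'A, hF'⟩ := exists_finset_subset_inter_balls_subset A hF (ε / 2)
      rw [mul_div_cancel₀ ε two_ne_zero] at hF'
      refine closedConvexGHull_mono (fun y hy => ?_) (hA F' hF'A a ha)
      exact ⟨subset_orbitHull A hy.1, fun hyF => hy.2 (hF' ⟨hy.1, hyF⟩)⟩
    · simpa using hHneg (-F) (mem_iInter₂.1 hx (-F) (Set.Finite.neg hF))
  exact hx₀F (mem_iInter₂.1 (hDI hx₀) F₀ F₀.finite_toSet)

variable [TopologicalSpace G] [IsLinearIsometricAction G X]

theorem isGInvariant_orbitHull (A : Set X) : IsGInvariant G (orbitHull G A) :=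
  IsGInvariant.closedAbsConvexHull fun g x hx => by
    obtain ⟨a, ha, hxa⟩ := mem_iUnion₂.1 hx
    exact mem_iUnion₂.2 ⟨a, ha, MulAction.mem_orbit_of_mem_orbit g hxa⟩

theorem isBounded_orbitHull {A : Set X} (hA : Bornology.IsBounded A) :
    Bornology.IsBounded (orbitHull G A) := by
  obtain ⟨R, hR⟩ := hA.exists_norm_le
  refine isBounded_closedBall.subset (orbitHull_min (K := closedBall 0 R)
    (fun a ha => by simpa using hR a ha) ⟨balanced_closedBall_zero, convex_closedBall 0 R⟩
    isClosed_closedBall fun g x hx => ?_)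
  simpa [IsLinearIsometricAction.norm_smul] using hx

theorem isSeparable_orbitHull [CompactSpace G] {A : Set X} (hA : A.Countable) :
    TopologicalSpace.IsSeparable (orbitHull G A) := by
  have hU : TopologicalSpace.IsSeparable (⋃ a ∈ A, MulAction.orbit G a) := by
    have := hA.to_subtype
    rw [biUnion_eq_iUnion]
    exact .iUnion fun a => (isCompact_orbit (a : X)).isSeparable
  refine hU.span (R := ℝ) |>.closure.mono <| closedAbsConvexHull_min
    (Submodule.subset_span.trans subset_closure) ?_ isClosed_closure
  refine AbsConvex.closure ⟨?_, Submodule.convex _⟩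
  exact (balanced_iff_neg_mem (Submodule.convex _)).2 fun x hx => neg_mem hx

end Reduction

theorem mainTheorem1 (G : Type*) (X : Type*)
    [Group G] [TopologicalSpace G] [IsTopologicalGroup G] [T2Space G] [CompactSpace G]
    [NormedAddCommGroup X] [NormedSpace ℝ X] [CompleteSpace X]
    [DistribMulAction G X] [IsLinearIsometricAction G X] :
    (HasGBishopPhelps G X → IsStronglyGDentable G X) ∧
    (∀ C : Set X, TopologicalSpace.IsSeparable C → Bornology.IsBounded C → IsClosed C →
      Convex ℝ C → IsGInvariant G C → SetHasGBishopPhelps G C → IsGDentable G C) := by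
  refine ⟨fun hX C hne hbdd _ => ?_, fun C hsep hbdd _ _ _ hC => hC.isGDentable hsep hbdd⟩
  by_contra hdent
  simp only [IsGDentable, not_forall, not_exists, not_and, not_not] at hdent
  obtain ⟨ε, hε, hC⟩ := hdent
  -- Countable witnesses, inside `C` minus the balls, of the failure of dentability.
  have hex (F : Finset X) (x : X) : ∃ B ⊆ C \ ⋃ y ∈ F, ball y ε, B.Countable ∧
      ((F : Set X) ⊆ C → x ∈ C → x ∈ closedConvexGHull G B) := by
    by_cases h : (F : Set X) ⊆ C ∧ x ∈ C
    · obtain ⟨B, hBV, hBc, hB⟩ := exists_countable_of_mem_closedConvexGHull (hC F h.1 x h.2)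
      exact ⟨B, hBV, hBc, fun _ _ => hB⟩
    · exact ⟨∅, empty_subset _, countable_empty, fun h1 h2 => absurd ⟨h1, h2⟩ h⟩
  choose Φ hΦ hΦc hΦx using hex
  obtain ⟨A, hAC, hAne, hAc, hAΦ⟩ := exists_countable_closed_under hne Φ hΦc
    fun F _ x _ => (hΦ F x).trans sdiff_subset
  have hsub (F : Finset X) (hF : (F : Set X) ⊆ A) (x : X) (hx : x ∈ A) :
      Φ F x ⊆ A \ ⋃ y ∈ F, ball y ε := fun y hy => ⟨hAΦ F hF x hx hy, (hΦ F x hy).2⟩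
  refine not_isGDentable_orbitHull (G := G) hε (A := A) (fun F hF x hx => ?_) <|
    (hX (orbitHull G A) (hAne.mono (subset_orbitHull A)) (isBounded_orbitHull (hbdd.subset hAC))
      isClosed_closedAbsConvexHull absConvex_convexClosedHull
      (isGInvariant_orbitHull A)).isGDentable
      (isSeparable_orbitHull hAc) (isBounded_orbitHull (hbdd.subset hAC))
  exact closedConvexGHull_mono (hsub F hF x hx) (hΦx F x (hF.trans hAC) (hAC hx))
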